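/- Let $n\ge 0$ and $m\ge 1$ be integers, let $\mathcal D$ be a metric space with its Borel $\sigma$-algebra and a probability measure $\mathbb P$, and let $c\in\mathbb R^n$. For $k=1,\dots,m$ let $\mathbb X_k\subset\mathbb R^n$ be compact and convex, let $\varepsilon_k\in[0,1]$, and let $f_k:\mathbb X_k\times\mathcal D\to\mathbb R$ be measurable, convex in the first argument for every $d\in\mathcal D$, and bounded in the second argument for every $x\in\mathbb X_k$. For samples $d_1,\dots,d_N\in\mathcal D$ consider the programs $$\mathrm{SCP}_k:\ \min_{x\in\mathbb X_k} c^\top x\ \text{ s.t. } f_k(x,d_i)\le 0\ \ (1\le i\le N),\qquad \mathrm{CCP}_k:\ \min_{x\in\mathbb X_k} c^\top x\ \text{ s.t. } \mathbb P[f_k(x,d)\le 0]\ge 1-\varepsilon_k,$$ and let $\mathrm{SP}$ (resp. $\mathrm{CP}$) be the program of minimizing $c^\top x$ over all $x$ that are feasible for at least one of $\mathrm{SCP}_1,\dots,\mathrm{SCP}_m$ (resp. $\mathrm{CCP}_1,\dots,\mathrm{CCP}_m$), where the samples are the same for all $k$. Assume that for every $k$, every sample size $M\ge 1$ and every $(d_1,\dots,d_M)\in\mathcal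 D^M$ the program $\mathrm{SCP}_k$ has exactly one optimizer, and that this optimizer is a measurable function of $(d_1,\dots,d_M)\in\mathcal D^M$ (with the product $\sigma$-algebra). Let $\beta\in(0,1]$ and suppose that $$\widetilde N(\vec\varepsilon,\beta):=\min\Big\{N\in\mathbb N\ \Big|\ \sum_{k=1}^m\sum_{i=0}^{n-1}\binom Ni\varepsilon_k^i(1-\varepsilon_k)^{N-i}\le\beta\Big\}$$ exists, i.e. that the set on the right is non-empty (with $0\in\mathbb N$ and $0^0=1$). Then for every $N\ge\widetilde N(\vec\varepsilon,\beta)$ the following holds. For all samples the program $\mathrm{SP}$ has an optimizer; the set of all $(d_1,\dots,d_N)\in\mathcal D^N$ for which every optimizer of $\mathrm{SP}$ is feasible for $\mathrm{CP}$ is measurable; and its probability under the product measure $\mathbb P^N$ is at least $1-\beta$. In particular, the optimizer of $\mathrm{SP}$, however it is selected in case of ties, is feasible for $\mathrm{CP}$ with probability at least $1-\beta$. -/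

import Mathlib

open MeasureTheory

namespace Scenario

/-- The minimizers of the linear objective `x ↦ cᵀ x` over a feasible set `S`. -/
def optimizers {n : ℕ} (c : EuclideanSpace ℝ (Fin n)) (S : Set (EuclideanSpace ℝ (Fin n))) :
    Set (EuclideanSpace ℝ (Fin n)) :=
  {x | x ∈ S ∧ ∀ y ∈ S, inner ℝ c x ≤ inner ℝ c y}

/-- Feasible set of the scenario convex program with samples `d 0, …, d (N - 1)`. -/
def scpFeasible {n : ℕ} {D : Type*} (X : Set (EuclideanSpace ℝ (Fin n)))
    (f : EuclideanSpace ℝ (Fin n) → D → ℝ) {N : ℕ} (d : Fin N → D) :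
    Set (EuclideanSpace ℝ (Fin n)) :=
  {x | x ∈ X ∧ ∀ i, f x (d i) ≤ 0}

/-- Feasible set of the chance-constrained program with violation level `ε`. -/
def ccpFeasible {n : ℕ} {D : Type*} [MeasurableSpace D] (P : Measure D)
    (X : Set (EuclideanSpace ℝ (Fin n))) (f : EuclideanSpace ℝ (Fin n) → D → ℝ) (ε : ℝ) :
    Set (EuclideanSpace ℝ (Fin n)) :=
  {x | x ∈ X ∧ 1 - ε ≤ P.real {d | f x d ≤ 0}}

/-- Feasible set of the non-convex scenario program: feasibility for at least one of the
scenario subprograms, all of them with the same samples. -/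
def spFeasible {n m : ℕ} {D : Type*} (X : Fin m → Set (EuclideanSpace ℝ (Fin n)))
    (f : Fin m → EuclideanSpace ℝ (Fin n) → D → ℝ) {N : ℕ} (d : Fin N → D) :
    Set (EuclideanSpace ℝ (Fin n)) :=
  {x | ∃ k, x ∈ scpFeasible (X k) (f k) d}

/-- Feasible set of the union chance-constrained program: feasibility for at least one of the
chance-constrained subprograms. -/
def cpFeasible {n m : ℕ} {D : Type*} [MeasurableSpace D] (P : Measure D)
    (X : Fin m → Set (EuclideanSpace ℝ (Fin n)))
    (f : Fin m → EuclideanSpace ℝ (Fin n) → D → ℝ) (ε : Fin m → ℝ) :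
    Set (EuclideanSpace ℝ (Fin n)) :=
  {x | ∃ k, x ∈ ccpFeasible P (X k) (f k) (ε k)}

/-- The standing assumption on a scenario convex program: for every sample size `N ≥ 1` and every
choice of the `N` samples it has exactly one optimizer, and this optimizer is a measurable
function of the samples. -/
def HasMeasurableUniqueOptimizer {n : ℕ} {D : Type*} [MeasurableSpace D]
    (c : EuclideanSpace ℝ (Fin n)) (X : Set (EuclideanSpace ℝ (Fin n)))
    (f : EuclideanSpace ℝ (Fin n) → D → ℝ) : Prop :=
  ∀ N : ℕ, 1 ≤ N → ∃ x : (Fin N → D) → EuclideanSpace ℝ (Fin n),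
    Measurable x ∧ ∀ d, optimizers c (scpFeasible X f d) = {x d}

/-- The sum `∑ₖ ∑_{i < n} (N choose i) εₖ ^ i (1 - εₖ) ^ (N - i)`. -/
def tailSum (n : ℕ) {m : ℕ} (ε : Fin m → ℝ) (N : ℕ) : ℝ :=
  ∑ k, ∑ i ∈ Finset.range n, (N.choose i : ℝ) * ε k ^ i * (1 - ε k) ^ (N - i)

end Scenario

/-! ### Counting subsets by violators in nondegenerate LP-type structures. -/

namespace Scenario

open Finset

/-! Every optimizer of the union program is the optimizer of some subprogram, so it can be
infeasible for the chance-constrained union only if some subprogram's optimizer has violation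
probability above its `ε k`. A union bound reduces the claim to one convex program, where this event
has probability at most the binomial tail (`measure_scp_violation_le`). The tails decrease in `N`,
so every larger sample size works too.

The single-program bound is combinatorial. In a pool of `N + T` samples, exchangeability bounds the
probability that the optimizer of the first `N` violates more than `r` of the rest by the fraction
of `N`-subsets whose optimizer violates more than `r` pool elements (`measure_prod_card_lt_le`). By
Helly's theorem at most `n` constraints determine an optimizer. After a generic perturbation
(`exists_nondegenerate_perturbation`) the subsets sharing a basis `B` form an interval `[B, Vᶜ]`,
with `V` the violated constraints, and a weighting of these intervals gives the count
(`card_filter_violators_le`). For `r = ⌊ε T⌋` and `T → ∞` the fraction tends to the binomial tail,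
while Chebyshev's inequality turns violation frequencies into probabilities. -/

lemma sum_Icc_finset_apply_card {ι : Type*} [DecidableEq ι] {B C : Finset ι} (h : B ⊆ C)
    (w : ℕ → ℤ) :
    ∑ J ∈ Icc B C, w #J = ∑ j ∈ range (#C - #B + 1), (#C - #B).choose j • w (#B + j) := by
  rw [Finset.Icc_eq_image_powerset h, Finset.sum_image]
  · rw [← card_sdiff_of_subset h, ← Finset.sum_powerset_apply_card (fun j => w (#B + j))]
    refine Finset.sum_congr rfl fun J hJ => ?_
    rw [Finset.card_union_of_disjoint]
    exact (disjoint_sdiff.mono_right (mem_powerset.1 hJ))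
  · intro J hJ K hK hJK
    have hJ' := disjoint_sdiff.mono_right (mem_powerset.1 hJ)
    have hK' := disjoint_sdiff.mono_right (mem_powerset.1 hK)
    have := congrArg (· \ B) hJK
    simpa [Finset.union_sdiff_cancel_left hJ', Finset.union_sdiff_cancel_left hK'] using this

/-- The number of `N`-subsets of a `w`-set, continued polynomially with degree `n - 1` from
`w = s + n` on. -/
def cutChoose (n N s k w : ℕ) : ℤ :=
  if w < s then (w.choose (N - k) : ℤ)
  else ∑ i ∈ range (n - k), ((w - s).choose i : ℤ) * (s.choose (N - k - i) : ℤ)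

lemma cutChoose_nonneg (n N s k w : ℕ) : 0 ≤ cutChoose n N s k w := by
  unfold cutChoose
  split_ifs <;> positivity

/-- Pascal's rule on either branch; at the seam `w + 1 = s` only the term `i = 0` survives. Thus
raising `k` is taking a forward difference in `w`. -/
lemma cutChoose_succ {n N s k : ℕ} (hnN : n ≤ N) (hk : k < n) (w : ℕ) :
    cutChoose n N s k (w + 1) = cutChoose n N s k w + cutChoose n N s (k + 1) w := by
  obtain ⟨a, ha⟩ : ∃ a, n - k = a + 1 := ⟨n - k - 1, by omega⟩
  obtain ⟨b, hb⟩ : ∃ b, N - k = b + 1 := ⟨N - k - 1, by omega⟩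
  have ha' : n - (k + 1) = a := by omega
  have hb' : N - (k + 1) = b := by omega
  unfold cutChoose
  rw [ha, hb, ha', hb']
  rcases lt_trichotomy (w + 1) s with h | h | h
  · rw [if_pos h, if_pos (by omega), if_pos (by omega), Nat.choose_succ_succ]
    push_cast; ring
  · rw [if_neg (by omega), if_pos (by omega), if_pos (by omega), Finset.sum_range_succ']
    subst h
    simp [Nat.choose_succ_succ, add_comm]
  · rw [if_neg (by omega), if_neg (by omega), if_neg (by omega)]
    have hw : w + 1 - s = (w - s) + 1 := by omega
    rw [hw, Finset.sum_range_succ', Finset.sum_range_succ' _ a, add_right_comm,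
      ← Finset.sum_add_distrib]
    congr 1
    · refine Finset.sum_congr rfl fun i _ => ?_
      rw [Nat.choose_succ_succ, show b + 1 - (i + 1) = b - i by omega]
      push_cast; ring
    · simp

lemma fwdDiff_iter_cutChoose {n N s : ℕ} (hnN : n ≤ N) (k : ℕ) (hk : k ≤ n) :
    ((fwdDiff 1)^[k] (cutChoose n N s 0)) = cutChoose n N s k := by
  induction k with
  | zero => rfl
  | succ k ih =>
    rw [Function.iterate_succ_apply', ih (by omega)]
    funext w
    rw [fwdDiff, cutChoose_succ hnN (by omega)]
    ring

/-- Vandermonde's identity: the terms cut off have `i ≥ n - k > w - s` and vanish. -/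
lemma choose_le_cutChoose {n N s k w : ℕ} (hnN : n ≤ N) (hk : k ≤ n) (hw : w + k < s + n) :
    (w.choose (N - k) : ℤ) ≤ cutChoose n N s k w := by
  unfold cutChoose
  split_ifs with h
  · rfl
  · have hws : w = (w - s) + s := by omega
    conv_lhs => rw [hws]
    rw [Nat.add_choose_eq, Finset.Nat.sum_antidiagonal_eq_sum_range_succ
      (fun i j => (w - s).choose i * s.choose j)]
    push_cast
    refine le_of_eq (Finset.sum_subset ?_ ?_).symm
    · intro i hi
      simp only [mem_range] at hi ⊢
      omega
    · intro i _ hi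
      simp only [mem_range, not_lt] at hi
      rw [Nat.choose_eq_zero_of_lt (by omega)]
      simp

/-- The counting bound for nondegenerate LP-type structures: `B I` is the basis of the set of
constraints `I` and `V I` is the set of constraints violated by its optimizer. -/
theorem card_filter_violators_le {ι : Type*} [Fintype ι] [DecidableEq ι] {n N r : ℕ}
    (B V : Finset ι → Finset ι) (hBI : ∀ I, B I ⊆ I) (hIV : ∀ I, Disjoint I (V I))
    (hcard : ∀ I, #(B I) ≤ n) (hloc : ∀ I J, B I ⊆ J → Disjoint J (V I) → B J = B I)
    (hBV : ∀ I J, B I = B J → V I = V J) (hnN : n ≤ N) (hr : r + n ≤ Fintype.card ι) :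
    #{I ∈ powersetCard N (univ : Finset ι) | r < #(V I)} ≤
      ∑ i ∈ range n, (r + n).choose i * (Fintype.card ι - r - n).choose (N - i) := by
  set M := Fintype.card ι with hM
  set s := M - r - n with hs
  set w : ℕ → ℤ := fun k => ((fwdDiff 1)^[k] (cutChoose n N s 0)) 0 with hw
  -- The weights are the Newton coefficients of `cutChoose n N s 0` at `0`, so the total weight of
  -- an interval `[B, C]` is the `#B`-th difference at `#C - #B`.
  have hshift : ∀ k a : ℕ, ∑ j ∈ range (a + 1), a.choose j • w (k + j)
      = ((fwdDiff 1)^[k] (cutChoose n N s 0)) a := by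
    intro k a
    have := shift_eq_sum_fwdDiff_iter 1 ((fwdDiff 1)^[k] (cutChoose n N s 0)) a 0
    rw [zero_add, nsmul_one, Nat.cast_id] at this
    rw [this]
    refine Finset.sum_congr rfl fun j _ => ?_
    rw [hw, ← Function.iterate_add_apply, add_comm k j]
  -- The fibres of `B` partition the power set into intervals. As the weight of the whole power set
  -- is the claimed bound, comparing count and weight on each fibre suffices.
  have hfib : ∀ I, {J ∈ (univ : Finset (Finset ι)) | B J = B I} = Icc (B I) (V I)ᶜ := by
    intro I
    ext J
    simp only [mem_filter, mem_univ, true_and, mem_Icc, subset_compl_iff_disjoint_right]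
    constructor
    · intro h
      exact ⟨h ▸ hBI J, hBV J I h ▸ hIV J⟩
    · rintro ⟨h1, h2⟩
      exact hloc I J h1 h2
  have hsub : ∀ I, B I ⊆ (V I)ᶜ := fun I =>
    subset_compl_iff_disjoint_right.2 ((hIV I).mono_left (hBI I))
  have htot : ∑ I : Finset ι, w #I = cutChoose n N s 0 M := by
    have h := sum_Icc_finset_apply_card (empty_subset (univ : Finset ι)) w
    rw [card_empty, card_univ, ← hM, Nat.sub_zero, hshift] at h
    have h2 : (univ : Finset (Finset ι)) = Icc ∅ univ := by
      ext J; simp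
    rw [h2, h]; rfl
  have hdec : ∀ g : Finset ι → ℤ, ∑ I, g I =
      ∑ b ∈ univ.image B, ∑ J ∈ univ with B J = b, g J := fun g =>
    (Finset.sum_fiberwise_of_maps_to (fun I _ => mem_image_of_mem B (mem_univ I)) g).symm
  have hRHS : cutChoose n N s 0 M
      = ((∑ i ∈ range n, (r + n).choose i * s.choose (N - i) : ℕ) : ℤ) := by
    unfold cutChoose
    rcases Nat.eq_zero_or_pos (r + n) with h0 | h0
    · obtain ⟨rfl, rfl⟩ : r = 0 ∧ n = 0 := by omega
      simp [hs]
    · rw [if_neg (by omega)]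
      have : M - s = r + n := by omega
      simp [this]
  have hLHS : (#{I ∈ powersetCard N (univ : Finset ι) | r < #(V I)} : ℤ) =
      ∑ I : Finset ι, if #I = N ∧ r < #(V I) then 1 else 0 := by
    rw [Finset.sum_boole]
    congr 2
    ext I
    simp [mem_powersetCard]
  rw [← Int.ofNat_le, hLHS, ← hRHS, ← htot, hdec, hdec]
  refine Finset.sum_le_sum fun b hb => ?_
  obtain ⟨I, -, rfl⟩ := mem_image.1 hb
  have hV : ∀ J ∈ ({J ∈ (univ : Finset (Finset ι)) | B J = B I}), V J = V I := fun J hJ =>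
    hBV J I (mem_filter.1 hJ).2
  have h1 : (∑ J ∈ univ with B J = B I, if #J = N ∧ r < #(V J) then (1 : ℤ) else 0) =
      ∑ J ∈ univ with B J = B I, (fun k => if k = N ∧ r < #(V I) then (1 : ℤ) else 0) #J :=
    Finset.sum_congr rfl fun J hJ => by rw [hV J hJ]
  rw [h1, hfib, sum_Icc_finset_apply_card (hsub I) w,
    sum_Icc_finset_apply_card (hsub I) (fun k => if k = N ∧ r < #(V I) then (1 : ℤ) else 0), hshift,
    fwdDiff_iter_cutChoose hnN _ (hcard I)]
  set a := #(V I)ᶜ - #(B I) with ha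
  -- More than `r` violators means `#(V I)ᶜ < s + n`, where the weight dominates the number of
  -- `N`-sets in the fibre. The other fibres count nothing and need only nonnegative weight.
  by_cases hrV : r < #(V I)
  · have hle := hcard I
    have h2 : a + #(B I) < s + n := by
      have h3 := card_le_card (hsub I)
      have h4 := card_compl (V I)
      have h5 : #(V I) ≤ M := card_le_univ _
      have h6 : #(V I) + #(B I) ≤ M := by omega
      omega
    refine le_trans (le_of_eq ?_) (choose_le_cutChoose hnN hle h2)
    simp only [hrV, and_true, smul_ite, smul_zero, nsmul_eq_mul, mul_one]
    rw [Finset.sum_ite, Finset.sum_const_zero, add_zero]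
    by_cases hNa : N - #(B I) ≤ a
    · rw [Finset.sum_eq_single_of_mem (N - #(B I))]
      · simp only [mem_filter, mem_range]
        omega
      · intro j hj hne
        simp only [mem_filter, mem_range] at hj
        omega
    · rw [Nat.choose_eq_zero_of_lt (by omega), Nat.cast_zero]
      refine Finset.sum_eq_zero fun j hj => ?_
      simp only [mem_filter, mem_range] at hj
      omega
  · simp only [hrV, and_false, if_false, smul_zero, Finset.sum_const_zero]
    exact cutChoose_nonneg _ _ _ _ _

end Scenario

/-! ### Perturbing a convex program into general position. -/

namespace Scenario

open Filter Topology

section Perturbation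

variable {E : Type*} [NormedAddCommGroup E] {ι : Type*}

/-- By compactness it is enough that every cluster point satisfies all limiting inequalities, which
single out `y`. This gives stability of unique optimizers. -/
lemma tendsto_of_sublevel_subset_singleton {α J : Type*} {l : Filter α} {K : Set E}
    (hK : IsCompact K) {h : J → E → ℝ} (hc : ∀ j, Continuous (h j)) {y : E}
    (huniq : ∀ x ∈ K, (∀ j, h j x ≤ 0) → x = y) {z : α → E} (hz : ∀ᶠ t in l, z t ∈ K)
    {b : J → α → ℝ} (hb : ∀ j, Tendsto (b j) l (𝓝 0))
    (hzb : ∀ j, ∀ᶠ t in l, h j (z t) ≤ b j t) : Tendsto z l (𝓝 y) := by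
  refine hK.le_nhds_of_unique_clusterPt hz fun x hx hcl => huniq x hx fun j => ?_
  refine le_of_forall_pos_le_add fun δ hδ => ?_
  rw [zero_add]
  have hclosed : IsClosed {x | h j x ≤ δ} := isClosed_le (hc j) continuous_const
  have hev : ∀ᶠ t in l, z t ∈ {x | h j x ≤ δ} := by
    filter_upwards [hzb j, (hb j).eventually (gt_mem_nhds hδ)] with t h1 h2
    exact h1.trans h2.le
  have : x ∈ closure {x | h j x ≤ δ} :=
    mem_closure_iff_clusterPt.2 (hcl.mono (le_principal_iff.2 hev))
  rwa [hclosed.closure_eq] at this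

/-- `y` minimizes `φ` over the points of `K` satisfying the constraints `g e ≤ u e` for `e ∈ I`. -/
def IsConstrainedMin (φ : E → ℝ) (K : Set E) (g : ι → E → ℝ) (u : ι → ℝ) (I : Finset ι) (y : E) :
    Prop :=
  (y ∈ K ∧ ∀ e ∈ I, g e y ≤ u e) ∧ ∀ z ∈ K, (∀ e ∈ I, g e z ≤ u e) → φ y ≤ φ z

variable {φ : E → ℝ} {K : Set E} {g : ι → E → ℝ} {u : ι → ℝ} {I : Finset ι}

lemma exists_isConstrainedMin (hK : IsCompact K) (hφ : Continuous φ) (hg : ∀ e, Continuous (g e))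
    {p : E} (hp : p ∈ K) (hgp : ∀ e, g e p ≤ u e) (I : Finset ι) :
    ∃ y, IsConstrainedMin φ K g u I y := by
  have hclosed : IsClosed {x | ∀ e ∈ I, g e x ≤ u e} := by
    simp only [Set.ofPred_forall]
    exact isClosed_iInter fun e => isClosed_iInter fun _ => isClosed_le (hg e) continuous_const
  obtain ⟨y, hy, hmin⟩ := (hK.inter_right hclosed).exists_isMinOn ⟨p, hp, fun e _ => hgp e⟩
    hφ.continuousOn
  exact ⟨y, hy, fun z hz hz' => hmin ⟨hz, hz'⟩⟩

variable [InnerProductSpace ℝ E]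

lemma convex_constraints (hKc : Convex ℝ K) (hgc : ∀ e, ConvexOn ℝ Set.univ (g e))
    (u : ι → ℝ) (I : Finset ι) : Convex ℝ {x | x ∈ K ∧ ∀ e ∈ I, g e x ≤ u e} := by
  have : {x | x ∈ K ∧ ∀ e ∈ I, g e x ≤ u e} = K ∩ ⋂ e ∈ I, {x | x ∈ Set.univ ∧ g e x ≤ u e} := by
    ext x; simp
  rw [this]
  exact hKc.inter (convex_iInter₂ fun e _ => (hgc e).convex_le _)

lemma IsConstrainedMin.eq_of_le (hKc : Convex ℝ K) (hgc : ∀ e, ConvexOn ℝ Set.univ (g e))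
    (hφ : StrictConvexOn ℝ Set.univ φ) {y z : E} (hy : IsConstrainedMin φ K g u I y) (hz : z ∈ K)
    (hzI : ∀ e ∈ I, g e z ≤ u e) (hle : φ z ≤ φ y) : z = y := by
  have hc := convex_constraints hKc hgc u I
  refine (hφ.subset (Set.subset_univ _) hc).eq_of_isMinOn (x := z) (y := y) ?_ ?_ ⟨hz, hzI⟩ hy.1
  · exact fun w hw => hle.trans (hy.2 w hw.1 hw.2)
  · exact fun w hw => hy.2 w hw.1 hw.2

lemma strictConvexOn_inner_add_sq (c : E) {η : ℝ} (hη : 0 < η) :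
    StrictConvexOn ℝ Set.univ fun x : E => inner ℝ c x + η * ‖x‖ ^ 2 := by
  have h : StrongConvexOn Set.univ (2 * η) fun x : E => inner ℝ c x + η * ‖x‖ ^ 2 := by
    rw [strongConvexOn_iff_convex]
    have : (fun x : E => inner ℝ c x + η * ‖x‖ ^ 2 - 2 * η / (2 : ℝ) * ‖x‖ ^ 2) =
        fun x => innerₛₗ ℝ c x := by
      funext x
      simp only [innerₛₗ_apply_apply]
      ring
    rw [this]
    exact (innerₛₗ ℝ c).convexOn convex_univ
  exact h.strictConvexOn (by positivity)

variable [Finite ι]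

/-- Any convex program over finitely many constraints can be perturbed so that the objective is
strictly convex, no violation at an optimizer disappears, and the boundary of a constraint never
contains the optimizer of a subproblem not involving this constraint. -/
theorem exists_nondegenerate_perturbation (hK : IsCompact K) (hKc : Convex ℝ K)
    (hg : ∀ e, Continuous (g e)) (hgc : ∀ e, ConvexOn ℝ Set.univ (g e))
    {p : E} (hp : p ∈ K) (hgp : ∀ e, g e p ≤ 0) (c : E) (x : Finset ι → E)
    (hx : ∀ I : Finset ι, I.Nonempty → (x I ∈ K ∧ ∀ e ∈ I, g e (x I) ≤ 0) ∧
      ∀ z ∈ K, (∀ e ∈ I, g e z ≤ 0) → inner ℝ c z ≤ inner ℝ c (x I) → z = x I) :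
    ∃ (φ : E → ℝ) (u : ι → ℝ) (y : Finset ι → E), StrictConvexOn ℝ Set.univ φ ∧ Continuous φ ∧
      (∀ e, 0 ≤ u e) ∧ (∀ I, IsConstrainedMin φ K g u I (y I)) ∧
      (∀ I : Finset ι, I.Nonempty → ∀ e, 0 < g e (x I) → u e < g e (y I)) ∧
      ∀ I, ∀ e ∉ I, g e (y I) ≠ u e := by
  classical
  have := Fintype.ofFinite ι
  suffices h : ∀ S : Finset ι, ∃ (φ : E → ℝ) (u : ι → ℝ) (y : Finset ι → E),
      StrictConvexOn ℝ Set.univ φ ∧ Continuous φ ∧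
      (∀ e, 0 ≤ u e) ∧ (∀ I, IsConstrainedMin φ K g u I (y I)) ∧
      (∀ I : Finset ι, I.Nonempty → ∀ e, 0 < g e (x I) → u e < g e (y I)) ∧
      ∀ I, ∀ e ∈ S, e ∉ I → g e (y I) ≠ u e by
    obtain ⟨φ, u, y, h1, h2, h3, h4, h5, h6⟩ := h Finset.univ
    exact ⟨φ, u, y, h1, h2, h3, h4, h5, fun I e he => h6 I e (Finset.mem_univ e) he⟩
  intro S
  induction S using Finset.induction_on with
  | empty =>
    -- Tikhonov regularization: as `η → 0+` the optimizers tend to the unique `x I`, so strict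
    -- violations persist for small `η`.
    set φ : ℝ → E → ℝ := fun η x => inner ℝ c x + η * ‖x‖ ^ 2 with hφdef
    have hφ : ∀ η, Continuous (φ η) := fun η => by fun_prop
    choose y hy using fun (η : ℝ) (I : Finset ι) =>
      exists_isConstrainedMin (u := fun _ => 0) hK (hφ η) hg hp hgp I
    have hlim : ∀ I : Finset ι, I.Nonempty → Tendsto (fun η => y η I) (𝓝[>] 0) (𝓝 (x I)) := by
      intro I hI
      refine tendsto_of_sublevel_subset_singleton (J := Option I) hK
        (h := fun j z => j.elim (inner ℝ c z - inner ℝ c (x I)) (fun e => g e z)) (y := x I)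
        ?_ ?_ (Eventually.of_forall fun η => (hy η I).1.1)
        (b := fun j η => j.elim (η * ‖x I‖ ^ 2) (fun _ => 0)) ?_ ?_
      · rintro (_ | e)
        · simp only [Option.elim_none]; fun_prop
        · exact hg e
      · intro z hz hz'
        refine (hx I hI).2 z hz (fun e he => hz' (some ⟨e, he⟩)) ?_
        have := hz' none
        simp only [Option.elim_none] at this
        linarith
      · rintro (_ | e)
        · have : Tendsto (fun η : ℝ => η * ‖x I‖ ^ 2) (𝓝 0) (𝓝 (0 * ‖x I‖ ^ 2)) :=
            tendsto_id.mul_const _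
          rw [zero_mul] at this
          exact this.mono_left nhdsWithin_le_nhds
        · exact tendsto_const_nhds
      · rintro (_ | e)
        · filter_upwards [self_mem_nhdsWithin] with η hη
          have h1 := (hy η I).2 (x I) (hx I hI).1.1 (hx I hI).1.2
          have h2 : 0 ≤ η * ‖y η I‖ ^ 2 := mul_nonneg (le_of_lt hη) (sq_nonneg _)
          simp only [hφdef, Option.elim_none] at h1 ⊢
          linarith
        · exact Eventually.of_forall fun η => (hy η I).1.2 e e.2
    have hev : ∀ᶠ η in 𝓝[>] (0 : ℝ), ∀ I : Finset ι, ∀ e, I.Nonempty → 0 < g e (x I) →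
        0 < g e (y η I) := by
      refine eventually_all.2 fun I => eventually_all.2 fun e => ?_
      by_cases hI : I.Nonempty
      · by_cases he : 0 < g e (x I)
        · filter_upwards [(((hg e).tendsto _).comp (hlim I hI)).eventually (lt_mem_nhds he)]
            with η hη _ _ using hη
        · exact Eventually.of_forall fun _ _ h => absurd h he
      · exact Eventually.of_forall fun _ h => absurd h hI
    obtain ⟨η, hη, hη0⟩ := (hev.and self_mem_nhdsWithin).exists
    exact ⟨φ η, fun _ => 0, y η, strictConvexOn_inner_add_sq c hη0, hφ η, fun _ => le_rfl, hy η,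
      fun I hI e he => hη I e hI he, by simp⟩
  | insert a S ha ih =>
    obtain ⟨φ, u, y, hφ, hφc, hu, hy, hviol, hgen⟩ := ih
    -- Only constraint `a` is relaxed. Subproblems without `a` keep their optimizers, so small `t >
    -- 0` avoids the finitely many bad levels; the properties already secured are strict and
    -- survive. The `max` keeps `p` feasible for every real `t`.
    set v : ℝ → ι → ℝ := fun t => Function.update u a (u a + max t 0) with hv
    have huv : ∀ t e, u e ≤ v t e := by
      intro t e
      simp only [hv, Function.update_apply]
      split_ifs with h
      · subst h; linarith [le_max_right t 0]
      · rfl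
    have hvlim : ∀ e, Tendsto (fun t => v t e) (𝓝[>] 0) (𝓝 (u e)) := by
      intro e
      by_cases h : e = a
      · subst h
        have hc : Continuous fun t : ℝ => u e + max t 0 := by fun_prop
        have := hc.tendsto 0
        simp only [max_self, add_zero] at this
        simpa [hv] using this.mono_left nhdsWithin_le_nhds
      · simp only [hv, Function.update_of_ne h]
        exact tendsto_const_nhds
    choose y' hy' using fun (t : ℝ) (I : Finset ι) =>
      exists_isConstrainedMin (u := v t) hK hφc hg hp
        (fun e => (hgp e).trans ((hu e).trans (huv t e))) I
    have hle : ∀ t I, φ (y' t I) ≤ φ (y I) := fun t I =>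
      (hy' t I).2 _ (hy I).1.1 fun e he => ((hy I).1.2 e he).trans (huv t e)
    have hsame : ∀ t I, a ∉ I → y' t I = y I := by
      intro t I haI
      refine (hy I).eq_of_le hKc hgc hφ (hy' t I).1.1 (fun e he => ?_) (hle t I)
      have h := (hy' t I).1.2 e he
      simpa only [hv, Function.update_of_ne (fun h' : e = a => haI (h' ▸ he))] using h
    have hlim : ∀ I : Finset ι, Tendsto (fun t => y' t I) (𝓝[>] 0) (𝓝 (y I)) := by
      intro I
      refine tendsto_of_sublevel_subset_singleton (J := Option I) hK
        (h := fun j z => j.elim (φ z - φ (y I)) (fun e => g e z - u e)) (y := y I)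
        ?_ ?_ (Eventually.of_forall fun t => (hy' t I).1.1)
        (b := fun j t => j.elim 0 (fun e => v t e - u e)) ?_ ?_
      · rintro (_ | e)
        · exact hφc.sub continuous_const
        · exact (hg e).sub continuous_const
      · intro z hz hz'
        refine (hy I).eq_of_le hKc hgc hφ hz (fun e he => ?_) ?_
        · exact sub_nonpos.1 (hz' (some ⟨e, he⟩))
        · exact sub_nonpos.1 (hz' none)
      · rintro (_ | e)
        · exact tendsto_const_nhds
        · simpa using (hvlim e).sub_const (u e)
      · rintro (_ | e)
        · exact Eventually.of_forall fun t => sub_nonpos.2 (hle t I)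
        · exact Eventually.of_forall fun t => sub_le_sub_right ((hy' t I).1.2 e e.2) _
    have hglim : ∀ I e, Tendsto (fun t => g e (y' t I)) (𝓝[>] 0) (𝓝 (g e (y I))) :=
      fun I e => ((hg e).tendsto _).comp (hlim I)
    have hev1 : ∀ᶠ t in 𝓝[>] (0 : ℝ), ∀ I : Finset ι, ∀ e, I.Nonempty → 0 < g e (x I) →
        v t e < g e (y' t I) := by
      refine eventually_all.2 fun I => eventually_all.2 fun e => ?_
      by_cases hI : I.Nonempty
      · by_cases he : 0 < g e (x I)
        · filter_upwards [(hvlim e).eventually_lt (hglim I e) (hviol I hI e he)]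
            with η hη _ _ using hη
        · exact Eventually.of_forall fun _ _ h => absurd h he
      · exact Eventually.of_forall fun _ h => absurd h hI
    have hev2 : ∀ᶠ t in 𝓝[>] (0 : ℝ), ∀ I : Finset ι, ∀ e, e ∈ insert a S → e ∉ I →
        g e (y' t I) ≠ v t e := by
      refine eventually_all.2 fun I => eventually_all.2 fun e => ?_
      by_cases heI : e ∈ I
      · exact Eventually.of_forall fun _ _ h => absurd heI h
      by_cases hea : e = a
      · subst hea
        have hne : ∀ᶠ t in 𝓝[>] (0 : ℝ), u e + t ≠ g e (y I) := by
          by_cases h : u e = g e (y I)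
          · filter_upwards [self_mem_nhdsWithin] with t ht
            rw [h]
            simpa using ht.ne'
          · have hc : Tendsto (fun t : ℝ => u e + t) (𝓝[>] 0) (𝓝 (u e + 0)) :=
              ((continuous_const.add continuous_id).tendsto 0).mono_left nhdsWithin_le_nhds
            rw [add_zero] at hc
            exact hc.eventually_ne h
        filter_upwards [hne, self_mem_nhdsWithin] with t ht ht0 _ _
        rw [hsame t I heI, hv]
        simp only [Function.update_self]
        rw [max_eq_left (le_of_lt ht0)]
        exact ht.symm
      · by_cases heS : e ∈ S
        · have h0 := hgen I e heS heI
          filter_upwards [((hglim I e).sub (hvlim e)).eventually_ne (sub_ne_zero.2 h0)]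
            with t ht _ _ using sub_ne_zero.1 ht
        · exact Eventually.of_forall fun _ h => absurd h (by simp [hea, heS])
    obtain ⟨t, ht1, ht2⟩ := (hev1.and hev2).exists
    exact ⟨φ, v t, y' t, hφ, hφc, fun e => (hu e).trans (huv t e), hy' t,
      fun I hI e he => ht1 I e hI he, ht2⟩

end Perturbation

end Scenario

/-! ### Combinatorial dimension via Helly, and the count for convex programs. -/

namespace Scenario

open Finset

/-- Convex combinations of nearest points are competitors. This turns compact convex sets into
continuous convex constraints. -/
lemma convexOn_infDist {E : Type*} [NormedAddCommGroup E] [NormedSpace ℝ E] {S : Set E}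
    (hS : Convex ℝ S) (hcomp : IsCompact S) (hne : S.Nonempty) :
    ConvexOn ℝ Set.univ fun x => Metric.infDist x S := by
  refine ⟨convex_univ, fun x _ y _ a b ha hb hab => ?_⟩
  obtain ⟨p, hp, hxp⟩ := hcomp.exists_infDist_eq_dist hne x
  obtain ⟨q, hq, hyq⟩ := hcomp.exists_infDist_eq_dist hne y
  simp only [hxp, hyq, smul_eq_mul]
  refine (Metric.infDist_le_dist_of_mem (hS hp hq ha hb hab)).trans ?_
  rw [dist_eq_norm, dist_eq_norm, dist_eq_norm]
  calc ‖a • x + b • y - (a • p + b • q)‖ = ‖a • (x - p) + b • (y - q)‖ := by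
        congr 1; module
    _ ≤ ‖a • (x - p)‖ + ‖b • (y - q)‖ := norm_add_le _ _
    _ = a * ‖x - p‖ + b * ‖y - q‖ := by
        rw [norm_smul, norm_smul, Real.norm_of_nonneg ha, Real.norm_of_nonneg hb]

section Finite

variable {E ι : Type*} {φ : E → ℝ} {K : Set E} {g : ι → E → ℝ} {u : ι → ℝ} {I : Finset ι}

lemma IsConstrainedMin.mono {J : Finset ι} {y : E} (hy : IsConstrainedMin φ K g u I y)
    (hIJ : I ⊆ J) (hyJ : ∀ e ∈ J, g e y ≤ u e) : IsConstrainedMin φ K g u J y :=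
  ⟨⟨hy.1.1, hyJ⟩, fun z hz hzJ => hy.2 z hz fun e he => hzJ e (hIJ he)⟩

variable [NormedAddCommGroup E] [InnerProductSpace ℝ E]

/-- Constraints which are inactive at the optimizer can be dropped. -/
lemma IsConstrainedMin.filter_active (hKc : Convex ℝ K)
    (hgc : ∀ e, ConvexOn ℝ Set.univ (g e)) (hφ : StrictConvexOn ℝ Set.univ φ) {y : E}
    (hy : IsConstrainedMin φ K g u I y) :
    IsConstrainedMin φ K g u {e ∈ I | g e y = u e} y := by
  refine ⟨⟨hy.1.1, fun e he => (mem_filter.1 he).2.le⟩, fun z hz hzI => ?_⟩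
  by_contra! hlt
  -- A short step from `y` towards a better `z` uses only the slack of the inactive constraints, so
  -- it stays feasible and improves `φ`.
  have hev : ∀ᶠ t in nhdsWithin (0 : ℝ) (Set.Ioi 0), ∀ e ∈ I,
      (1 - t) * g e y + t * g e z ≤ u e := by
    refine (Filter.eventually_all_finset I).2 fun e he => ?_
    by_cases hact : g e y = u e
    · have hz' := hzI e (mem_filter.2 ⟨he, hact⟩)
      filter_upwards [self_mem_nhdsWithin] with t (ht : 0 < t)
      rw [hact]
      nlinarith
    · have hlt : g e y < u e := lt_of_le_of_ne (hy.1.2 e he) hact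
      have hc : Continuous fun t : ℝ => (1 - t) * g e y + t * g e z := by fun_prop
      have := hc.tendsto 0
      simp only [sub_zero, one_mul, zero_mul, add_zero] at this
      filter_upwards [nhdsWithin_le_nhds (this.eventually (gt_mem_nhds hlt))] with t ht using ht.le
  have h1 : ∀ᶠ t in nhdsWithin (0 : ℝ) (Set.Ioi 0), t < 1 :=
    nhdsWithin_le_nhds (gt_mem_nhds one_pos)
  obtain ⟨t, ⟨ht, ht1⟩, (ht0 : 0 < t)⟩ := ((hev.and h1).and self_mem_nhdsWithin).exists
  have hcomb := hy.2 ((1 - t) • y + t • z)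
    (hKc hy.1.1 hz (by linarith) ht0.le (by ring)) fun e he => by
      have := (hgc e).2 (Set.mem_univ y) (Set.mem_univ z) (by linarith : 0 ≤ 1 - t)
        ht0.le (by ring)
      simp only [smul_eq_mul] at this
      exact this.trans (ht e he)
  have h2 := hφ.convexOn.2 (Set.mem_univ y) (Set.mem_univ z) (by linarith : 0 ≤ 1 - t)
    ht0.le (by ring)
  simp only [smul_eq_mul] at h2
  nlinarith

variable [FiniteDimensional ℝ E]

/-- By Helly's theorem, at most `dim E` constraints already determine the optimizer. -/
lemma IsConstrainedMin.exists_subset_card_le (hKc : Convex ℝ K)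
    (hgc : ∀ e, ConvexOn ℝ Set.univ (g e)) (hφ : StrictConvexOn ℝ Set.univ φ)
    {y : Finset ι → E} (hy : ∀ I, IsConstrainedMin φ K g u I (y I)) (I : Finset ι) :
    ∃ J ⊆ I, #J ≤ Module.finrank ℝ E ∧ y J = y I := by
  classical
  by_contra! hne
  -- Helly's theorem is applied to the constraint sets together with the set of strictly better
  -- points (index `none`). A subfamily containing `none` has at most `dim E` constraints, whose
  -- optimizer would be strictly better than `y I`.
  set F : Option ι → Set E := fun j =>
    j.elim {x | x ∈ K ∧ φ x < φ (y I)} (fun e => {x | x ∈ K ∧ g e x ≤ u e}) with hF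
  have hcard : ∀ J : Finset (Option ι), J ⊆ insertNone I → eraseNone J ⊆ I := by
    intro J hJ e he
    simpa using hJ (mem_eraseNone.1 he)
  obtain ⟨z, hz⟩ : (⋂ j ∈ insertNone I, F j).Nonempty := by
    refine Convex.helly_theorem' (𝕜 := ℝ) ?_ ?_
    · rintro (_ | e) _
      · exact (hφ.convexOn.subset (Set.subset_univ _) hKc).convex_lt _
      · exact ((hgc e).subset (Set.subset_univ _) hKc).convex_le _
    · intro J hJ hJc
      by_cases hnone : none ∈ J
      · have hJI := hcard J hJ
        have hc : #(eraseNone J) ≤ Module.finrank ℝ E := by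
          rw [card_eraseNone_of_mem hnone]
          omega
        refine ⟨y (eraseNone J), Set.mem_iInter₂.2 ?_⟩
        rintro (_ | e) he
        · refine ⟨(hy _).1.1, lt_of_not_ge fun hle => hne _ hJI hc ?_⟩
          have h1 : φ (y (eraseNone J)) ≤ φ (y I) :=
            (hy _).2 _ (hy I).1.1 fun e he => (hy I).1.2 e (hJI he)
          exact ((hy _).eq_of_le hKc hgc hφ (hy I).1.1
            (fun e he => (hy I).1.2 e (hJI he)) hle).symm
        · exact ⟨(hy _).1.1, (hy _).1.2 e (mem_eraseNone.2 he)⟩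
      · refine ⟨y I, Set.mem_iInter₂.2 ?_⟩
        rintro (_ | e) he
        · exact absurd he hnone
        · exact ⟨(hy I).1.1, (hy I).1.2 e (by simpa using hJ he)⟩
  have hz' : ∀ j ∈ insertNone I, z ∈ F j := fun j hj => Set.mem_iInter₂.1 hz j hj
  have h0 := hz' none (by simp)
  exact absurd ((hy I).2 z h0.1 fun e he => (hz' (some e) (by simpa using he)).2)
    (not_le.2 h0.2)

variable [Fintype ι]

open Classical in
/-- For convex programs with uniquely solvable subprograms over a pool of constraints, the number
of `N`-subsets of the pool whose optimizer violates more than `r` constraints is at most the number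
of `N`-subsets with less than `n` elements among `r + n` given elements. -/
theorem card_filter_not_mem_le {n N r : ℕ} (hn : Module.finrank ℝ E = n) (hN : 1 ≤ N)
    (hnN : n ≤ N) (hr : r + n ≤ Fintype.card ι) {C : ι → Set E} (hC : ∀ e, Convex ℝ (C e))
    (c : E) (x : Finset ι → E) (hx : ∀ I : Finset ι, I.Nonempty → (∀ e ∈ I, x I ∈ C e) ∧
      ∀ z, (∀ e ∈ I, z ∈ C e) → inner ℝ c z ≤ inner ℝ c (x I) → z = x I) :
    #{I ∈ powersetCard N (univ : Finset ι) | r < #{e | x I ∉ C e}} ≤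
      ∑ i ∈ range n, (r + n).choose i * (Fintype.card ι - r - n).choose (N - i) := by
  rcases isEmpty_or_nonempty ι with hι | hι
  · rw [powersetCard_eq_empty.2 (by simpa using (by omega : 0 < N))]
    simp
  -- The sets `C e` need not be closed. These smaller polytopes still contain the relevant `x I`,
  -- keep each one the unique optimizer, and can only add violations.
  set C' : ι → Set E := fun e => convexHull ℝ (x '' {I | e ∈ I}) with hC'
  set K : Set E := convexHull ℝ (x '' {I | I.Nonempty}) with hK
  set g : ι → E → ℝ := fun e z => Metric.infDist z (C' e) with hg
  have hfin : ∀ S : Set (Finset ι), (x '' S).Finite := fun S => (Set.toFinite S).image x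
  have hC'comp : ∀ e, IsCompact (C' e) := fun e => (hfin _).isCompact_convexHull ℝ
  have hC'ne : ∀ e, (C' e).Nonempty := fun e =>
    ⟨x {e}, subset_convexHull ℝ _ ⟨{e}, by simp, rfl⟩⟩
  have hC'sub : ∀ e, C' e ⊆ C e := fun e => convexHull_min (by
    rintro _ ⟨I, hI, rfl⟩
    exact (hx I ⟨e, hI⟩).1 e hI) (hC e)
  have hgz : ∀ e z, g e z ≤ 0 ↔ z ∈ C' e := fun e z => by
    rw [(hC'comp e).isClosed.mem_iff_infDist_zero (hC'ne e)]
    exact ⟨fun h => le_antisymm h Metric.infDist_nonneg, fun h => h.le⟩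
  have hxC' : ∀ I e, e ∈ I → x I ∈ C' e := fun I e he =>
    subset_convexHull ℝ _ ⟨I, he, rfl⟩
  have hgc : ∀ e, ConvexOn ℝ Set.univ (g e) := fun e =>
    convexOn_infDist (convex_convexHull ℝ _) (hC'comp e) (hC'ne e)
  have hKc : Convex ℝ K := convex_convexHull ℝ _
  obtain ⟨φ, u, y, hφ, -, -, hy, hviol, hgen⟩ :=
    exists_nondegenerate_perturbation (g := g) (K := K) (p := x univ)
      ((hfin _).isCompact_convexHull ℝ) hKc
      (fun e => Metric.continuous_infDist_pt _) hgc
      (subset_convexHull ℝ _ ⟨univ, univ_nonempty, rfl⟩)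
      (fun e => (hgz e _).2 (hxC' _ e (mem_univ e))) c x
      (fun I hI => ⟨⟨subset_convexHull ℝ _ ⟨I, hI, rfl⟩, fun e he => (hgz e _).2 (hxC' I e he)⟩,
        fun z _ hz hle => (hx I hI).2 z (fun e he => hC'sub e ((hgz e z).1 (hz e he))) hle⟩)
  -- All active constraints are taken, not only those in `I`, so that `B I` depends on `y I` alone;
  -- general position then forces `B I ⊆ I`.
  set B : Finset ι → Finset ι := fun I => {e | g e (y I) = u e} with hB
  set V : Finset ι → Finset ι := fun I => {e | u e < g e (y I)} with hV
  have hBI : ∀ I, B I ⊆ I := fun I e he => by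
    by_contra h
    exact hgen I e h (mem_filter.1 he).2
  have hBmin : ∀ I, IsConstrainedMin φ K g u (B I) (y I) := fun I => by
    have h := (hy I).filter_active hKc hgc hφ
    have h2 : ({e ∈ I | g e (y I) = u e} : Finset ι) = B I := by
      ext e
      simp only [mem_filter, hB, mem_univ, true_and, and_iff_right_iff_imp]
      exact fun he => hBI I (by simpa [hB] using he)
    rwa [h2] at h
  have heq : ∀ I J, IsConstrainedMin φ K g u J (y I) → y J = y I := fun I J h =>
    h.eq_of_le hKc hgc hφ (hy J).1.1 (hy J).1.2 ((hy J).2 _ h.1.1 h.1.2)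
  have hyB : ∀ I, y (B I) = y I := fun I => heq I _ (hBmin I)
  refine le_trans (card_le_card ?_) (card_filter_violators_le (n := n) (N := N) (r := r) B V hBI
    ?_ ?_ ?_ ?_ hnN hr)
  · intro I hI
    rw [mem_filter] at hI ⊢
    refine ⟨hI.1, hI.2.trans_le (card_le_card fun e he => ?_)⟩
    simp only [hV, mem_filter, mem_univ, true_and] at he ⊢
    have hIne : I.Nonempty := card_pos.1 (by rw [(mem_powersetCard.1 hI.1).2]; omega)
    exact hviol I hIne e (lt_of_not_ge fun h => he (hC'sub e ((hgz e _).1 h)))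
  · intro I
    rw [disjoint_left]
    intro e he he'
    exact absurd ((hy I).1.2 e he) (not_le.2 (mem_filter.1 he').2)
  · intro I
    obtain ⟨J, -, hJc, hJ⟩ := IsConstrainedMin.exists_subset_card_le hKc hgc hφ hy I
    -- A Helly subset `J` has the same optimizer, hence `B I = B J ⊆ J`.
    have : B I = B J := by simp only [hB, hJ]
    rw [this, ← hn]
    exact (card_le_card (hBI J)).trans hJc
  · intro I J hIJ hJV
    have : y J = y I := heq I J ((hBmin I).mono hIJ fun e he => by
      by_contra h
      exact disjoint_left.1 hJV he (by simpa [hV] using h))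
    simp only [hB, this]
  · intro I J hIJ
    have : y I = y J := by rw [← hyB I, hIJ, hyB J]
    simp only [hV, this]

end Finite

end Scenario

/-! ### From counting in finite pools to violation probabilities. -/

namespace Scenario

open Finset Filter Topology

lemma tendsto_choose_div_pow {a : ℕ → ℕ} {α : ℝ}
    (ha : Tendsto (fun T => (a T : ℝ) / T) atTop (𝓝 α)) (i : ℕ) :
    Tendsto (fun T => ((a T).choose i : ℝ) / (T : ℝ) ^ i) atTop (𝓝 (α ^ i / i.factorial)) := by
  induction i with
  | zero => simp
  | succ i ih =>
    have hchoose : ∀ m : ℕ, (m.choose (i + 1) : ℝ) = m.choose i * ((m : ℝ) - i) / (i + 1) := by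
      intro m
      rw [eq_div_iff (by positivity)]
      have h := Nat.choose_succ_right_eq m i
      rcases le_or_gt i m with hm | hm
      · rw [← Nat.cast_sub hm]
        exact_mod_cast h
      · rw [Nat.choose_eq_zero_of_lt hm, Nat.choose_eq_zero_of_lt (by omega)]
        simp
    have hi : Tendsto (fun T : ℕ => (i : ℝ) / T) atTop (𝓝 0) :=
      tendsto_const_div_atTop_nhds_zero_nat _
    have h := (ih.mul (ha.sub hi)).div_const ((i : ℝ) + 1)
    have hlim : α ^ i / i.factorial * (α - 0) / (i + 1) = α ^ (i + 1) / (i + 1).factorial := by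
      rw [Nat.factorial_succ]
      push_cast
      field_simp
      ring
    rw [hlim] at h
    refine h.congr fun T => ?_
    rw [hchoose]
    ring

/-- Drawing `N` elements from a large pool with a marked fraction near `ε` is asymptotically drawing
with replacement; numerator and denominator are scaled by `T ^ N`. -/
lemma tendsto_hypergeometric_tail {n N : ℕ} (hnN : n ≤ N) {ε : ℝ} (h0 : 0 ≤ ε) (h1 : ε ≤ 1) :
    Tendsto (fun T : ℕ => ((∑ i ∈ range n, (⌊ε * T⌋₊ + n).choose i *
        (N + T - ⌊ε * T⌋₊ - n).choose (N - i) : ℕ) : ℝ) / ((N + T).choose N : ℝ)) atTop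
      (𝓝 (∑ i ∈ range n, (N.choose i : ℝ) * ε ^ i * (1 - ε) ^ (N - i))) := by
  have hfloor : ∀ T : ℕ, ⌊ε * T⌋₊ ≤ T := fun T =>
    Nat.floor_le_of_le (mul_le_of_le_one_left (Nat.cast_nonneg T) h1)
  have hc : ∀ c : ℝ, Tendsto (fun T : ℕ => c / (T : ℝ)) atTop (𝓝 0) := fun c =>
    tendsto_const_div_atTop_nhds_zero_nat _
  have hT : Tendsto (fun T : ℕ => (T : ℝ) / T) atTop (𝓝 1) := by
    refine tendsto_const_nhds.congr' ?_
    filter_upwards [eventually_gt_atTop 0] with T hT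
    rw [div_self (by positivity)]
  have hr : Tendsto (fun T : ℕ => (⌊ε * T⌋₊ : ℝ) / T) atTop (𝓝 ε) :=
    (tendsto_nat_floor_mul_div_atTop h0).comp tendsto_natCast_atTop_atTop
  have ha : Tendsto (fun T : ℕ => ((⌊ε * T⌋₊ + n : ℕ) : ℝ) / T) atTop (𝓝 ε) := by
    simpa [add_div] using hr.add (hc n)
  have hb : Tendsto (fun T : ℕ => ((N + T - ⌊ε * T⌋₊ - n : ℕ) : ℝ) / T) atTop (𝓝 (1 - ε)) := by
    have h := ((hc ((N : ℝ) - n)).add hT).sub hr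
    rw [zero_add] at h
    refine h.congr fun T => ?_
    have := hfloor T
    rw [Nat.cast_sub (by omega), Nat.cast_sub (by omega)]
    push_cast
    ring
  have hM : Tendsto (fun T : ℕ => ((N + T : ℕ) : ℝ) / T) atTop (𝓝 1) := by
    simpa [add_div] using (hc N).add hT
  have hMN := tendsto_choose_div_pow hM N
  simp only [Nat.cast_sum, Nat.cast_mul, Finset.sum_div]
  refine tendsto_finsetSum _ fun i hi => ?_
  have hiN : i ≤ N := by
    have := mem_range.1 hi
    omega
  have h := ((tendsto_choose_div_pow ha i).mul (tendsto_choose_div_pow hb (N - i))).div hMN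
    (by positivity)
  have hlim : ε ^ i / i.factorial * ((1 - ε) ^ (N - i) / (N - i).factorial) /
      (1 ^ N / N.factorial) = (N.choose i : ℝ) * ε ^ i * (1 - ε) ^ (N - i) := by
    rw [Nat.cast_choose ℝ hiN]
    field_simp
    simp
  rw [hlim] at h
  refine h.congr' ?_
  filter_upwards [eventually_gt_atTop 0] with T hT
  have hT' : (T : ℝ) ≠ 0 := by positivity
  have hpow : (T : ℝ) ^ N = (T : ℝ) ^ i * (T : ℝ) ^ (N - i) := by
    rw [← pow_add, Nat.add_sub_cancel' hiN]
  simp only [Pi.div_apply]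
  rw [hpow, div_mul_div_comm, div_div_div_cancel_right₀ (by positivity)]

open Classical in
lemma measurableSet_lt_card {D : Type*} [MeasurableSpace D] {N T : ℕ} {S : Set ((Fin N → D) × D)}
    (hS : MeasurableSet S) (r : ℕ) :
    MeasurableSet {p : (Fin N → D) × (Fin T → D) | r < #{j | (p.1, p.2 j) ∈ S}} := by
  have h1 : Measurable fun p : (Fin N → D) × (Fin T → D) =>
      ∑ j, S.indicator (1 : (Fin N → D) × D → ℝ) (p.1, p.2 j) := by
    refine Finset.measurable_sum _ fun j _ => (measurable_one.indicator hS).comp ?_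
    exact measurable_fst.prodMk ((measurable_pi_apply j).comp measurable_snd)
  have h2 : {p : (Fin N → D) × (Fin T → D) | r < #{j | (p.1, p.2 j) ∈ S}} =
      {p | (r : ℝ) < ∑ j, S.indicator (1 : (Fin N → D) × D → ℝ) (p.1, p.2 j)} := by
    ext p
    simp only [Set.mem_ofPred_eq, Set.indicator_apply, Pi.one_apply, Finset.sum_boole,
      Nat.cast_lt]
  rw [h2]
  exact measurableSet_lt measurable_const h1

section Probability

variable {D : Type*} [MeasurableSpace D] (P : Measure D) [IsProbabilityMeasure P]

-- Chebyshev's inequality: the number of hits has mean at least `(ε + δ) T` and variance at most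
-- `T`.
open Classical in
lemma measure_pi_card_le_floor {S : Set D} (hS : MeasurableSet S) {ε δ : ℝ}
    (h0 : 0 ≤ ε) (hδ : 0 < δ) (hSε : ε + δ ≤ P.real S) {T : ℕ} (hT : 0 < T) :
    (Measure.pi fun _ : Fin T => P) {d | #{j | d j ∈ S} ≤ ⌊ε * T⌋₊} ≤
      ENNReal.ofReal (1 / (δ ^ 2 * T)) := by
  set Y : D → ℝ := S.indicator 1 with hY
  have hYm : Measurable Y := measurable_one.indicator hS
  have hYb : ∀ e, Y e ∈ Set.Icc (0 : ℝ) 1 := fun e => by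
    simp only [hY, Set.indicator_apply]
    split_ifs <;> simp
  have hYL : MemLp Y 2 P := memLp_of_bounded (Eventually.of_forall hYb)
    hYm.aestronglyMeasurable 2
  have hYe : ∫ e, Y e ∂P = P.real S := by
    rw [hY, integral_indicator_one hS]
  set Z : (Fin T → D) → ℝ := ∑ j, fun d => Y (d j) with hZ
  have hZL : MemLp Z 2 (Measure.pi fun _ : Fin T => P) :=
    memLp_finsetSum' _ fun j _ =>
      hYL.comp_measurePreserving (measurePreserving_eval (fun _ : Fin T => P) j)
  have hZe : ∫ d, Z d ∂(Measure.pi fun _ : Fin T => P) = T * P.real S := by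
    simp only [hZ, Finset.sum_apply]
    rw [integral_finsetSum]
    · have : ∀ j : Fin T, ∫ d, Y (d j) ∂(Measure.pi fun _ : Fin T => P) = P.real S := fun j => by
        rw [← hYe]
        exact integral_comp_eval (μ := fun _ : Fin T => P) (f := Y) hYm.aestronglyMeasurable
      simp [this]
    · intro j _
      exact (hYL.comp_measurePreserving
        (measurePreserving_eval (fun _ : Fin T => P) j)).integrable (by norm_num)
  have hZv : ProbabilityTheory.variance Z (Measure.pi fun _ : Fin T => P) ≤ T := by
    rw [hZ, ProbabilityTheory.variance_sum_pi (fun _ => hYL)]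
    refine (Finset.sum_le_sum (g := fun _ => (1 : ℝ)) fun j _ => ?_).trans (by simp)
    refine (ProbabilityTheory.variance_le_sq_of_bounded (Eventually.of_forall hYb)
      hYm.aemeasurable).trans ?_
    norm_num
  have hT' : (0 : ℝ) < T := Nat.cast_pos.2 hT
  have hcheb := ProbabilityTheory.meas_ge_le_variance_div_sq hZL (c := δ * T) (by positivity)
  refine (measure_mono fun d hd => ?_).trans (hcheb.trans (ENNReal.ofReal_le_ofReal ?_))
  · have hcard : Z d = #{j | d j ∈ S} := by
      simp only [hZ, hY, Finset.sum_apply, Set.indicator_apply, Pi.one_apply]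
      rw [Finset.sum_boole]
    have hd1 : (#{j | d j ∈ S} : ℝ) ≤ ε * T :=
      (Nat.cast_le.2 hd).trans (Nat.floor_le (by positivity))
    have hd2 : (ε + δ) * T ≤ T * P.real S := by
      rw [mul_comm]
      exact mul_le_mul_of_nonneg_left hSε hT'.le
    simp only [Set.mem_ofPred_eq]
    rw [hZe, hcard, abs_sub_comm]
    exact le_trans (by linarith) (le_abs_self _)
  · rw [div_le_div_iff₀ (by positivity) (by positivity)]
    nlinarith [mul_pos hT' (mul_pos (pow_pos hδ 2) hT')]

lemma exists_perm_map_inl_eq {N T : ℕ} (I : Finset (Fin N ⊕ Fin T)) (hI : #I = N) :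
    ∃ σ : Equiv.Perm (Fin N ⊕ Fin T),
      (univ : Finset (Fin N)).map (Function.Embedding.inl.trans σ.toEmbedding) = I := by
  classical
  have hcard : Fintype.card {x // x ∈ (univ : Finset (Fin N)).map
      (Function.Embedding.inl : Fin N ↪ Fin N ⊕ Fin T)} = Fintype.card {x // x ∈ I} := by
    rw [Fintype.card_coe, Fintype.card_coe, card_map, card_univ, Fintype.card_fin, hI]
  refine ⟨(Fintype.equivOfCardEq hcard).extendSubtype, ?_⟩
  refine Finset.eq_of_subset_of_card_le (fun e he => ?_) (by simp [hI])
  obtain ⟨a, -, rfl⟩ := mem_map.1 he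
  exact Equiv.extendSubtype_mem (Fintype.equivOfCardEq hcard) _ (mem_map_of_mem _ (mem_univ a))

open Classical in
/-- If among all `N`-subsets of any pool of samples at most `b` violate more than `r` elements of
the pool, then this bounds the probability of more than `r` violations in a fresh test sample. -/
lemma measure_prod_card_lt_le {N T r b : ℕ} {S : Set ((Fin N → D) × D)} (hS : MeasurableSet S)
    (hV : ∀ ω : Fin N ⊕ Fin T → D, ∃ V : Finset (Fin N ⊕ Fin T) → Finset (Fin N ⊕ Fin T),
      (∀ (σ : Fin N ↪ Fin N ⊕ Fin T) (e), e ∈ V (univ.map σ) ↔ (ω ∘ σ, ω e) ∈ S) ∧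
      #{I ∈ powersetCard N univ | r < #(V I)} ≤ b) :
    ((N + T).choose N : ENNReal) * ((Measure.pi fun _ : Fin N => P).prod
      (Measure.pi fun _ : Fin T => P)) {p | r < #{j | (p.1, p.2 j) ∈ S}} ≤ b := by
  set A : Set ((Fin N → D) × (Fin T → D)) := {p | r < #{j | (p.1, p.2 j) ∈ S}} with hA
  have hAm : MeasurableSet A := measurableSet_lt_card hS r
  set μ : Measure (Fin N ⊕ Fin T → D) := Measure.pi fun _ => P with hμ
  set A' : Set (Fin N ⊕ Fin T → D) :=
    MeasurableEquiv.sumPiEquivProdPi (fun _ : Fin N ⊕ Fin T => D) ⁻¹' A with hA'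
  have hA'm : MeasurableSet A' := (MeasurableEquiv.measurable _) hAm
  have hμA : μ A' = ((Measure.pi fun _ : Fin N => P).prod (Measure.pi fun _ : Fin T => P)) A :=
    (measurePreserving_sumPiEquivProdPi (fun _ : Fin N ⊕ Fin T => P)).measure_preimage
      hAm.nullMeasurableSet
  rw [← hμA]
  have hex : ∀ I : Finset (Fin N ⊕ Fin T), ∃ σ : Equiv.Perm (Fin N ⊕ Fin T), #I = N →
      (univ : Finset (Fin N)).map (Function.Embedding.inl.trans σ.toEmbedding) = I := by
    intro I
    by_cases hI : #I = N
    · obtain ⟨σ, hσ⟩ := exists_perm_map_inl_eq I hI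
      exact ⟨σ, fun _ => hσ⟩
    · exact ⟨1, fun h => absurd h hI⟩
  choose σ hσ using hex
  have hpre : ∀ I, MeasurePreserving (fun ω : Fin N ⊕ Fin T → D => ω ∘ σ I) μ μ := by
    intro I
    have h := measurePreserving_piCongrLeft (fun _ : Fin N ⊕ Fin T => P) (σ I).symm
    have h2 : (MeasurableEquiv.piCongrLeft (fun _ : Fin N ⊕ Fin T => D) (σ I).symm :
        (Fin N ⊕ Fin T → D) → Fin N ⊕ Fin T → D) = fun ω => ω ∘ σ I := by
      funext ω e
      have := MeasurableEquiv.piCongrLeft_apply_apply (σ I).symm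
        (β := fun _ : Fin N ⊕ Fin T => D) ω (σ I e)
      rwa [Equiv.symm_apply_apply] at this
    rwa [h2] at h
  have hmeas : ∀ I, MeasurableSet ((fun ω : Fin N ⊕ Fin T → D => ω ∘ σ I) ⁻¹' A') := fun I =>
    (hpre I).measurable hA'm
  -- Permuting coordinates preserves `μ`, so each `N`-subset may serve as the training sample with
  -- the same probability. The sum over subsets is then bounded pointwise, since violated test
  -- points inject into `V I`.
  calc ((N + T).choose N : ENNReal) * μ A'
      = ∑ I ∈ powersetCard N (univ : Finset (Fin N ⊕ Fin T)),
          μ ((fun ω : Fin N ⊕ Fin T → D => ω ∘ σ I) ⁻¹' A') := by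
        rw [Finset.sum_congr rfl fun I _ => (hpre I).measure_preimage hA'm.nullMeasurableSet,
          Finset.sum_const, card_powersetCard]
        simp
    _ = ∑ I ∈ powersetCard N (univ : Finset (Fin N ⊕ Fin T)),
          ∫⁻ ω, ((fun ω : Fin N ⊕ Fin T → D => ω ∘ σ I) ⁻¹' A').indicator 1 ω ∂μ := by
        refine Finset.sum_congr rfl fun I _ => ?_
        rw [lintegral_indicator_one (hmeas I)]
    _ = ∫⁻ ω, ∑ I ∈ powersetCard N (univ : Finset (Fin N ⊕ Fin T)),
          ((fun ω : Fin N ⊕ Fin T → D => ω ∘ σ I) ⁻¹' A').indicator 1 ω ∂μ := by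
        rw [lintegral_finsetSum]
        exact fun I _ => measurable_one.indicator (hmeas I)
    _ ≤ ∫⁻ _, (b : ENNReal) ∂μ := by
        refine lintegral_mono fun ω => ?_
        obtain ⟨V, hVS, hVb⟩ := hV ω
        simp only [Set.indicator_apply, Pi.one_apply, Finset.sum_boole]
        refine Nat.cast_le.2 (le_trans (card_le_card fun I hI => ?_) hVb)
        rw [mem_filter] at hI ⊢
        refine ⟨hI.1, lt_of_lt_of_le (b := #{j | ((fun i => ω (σ I (Sum.inl i))),
          ω (σ I (Sum.inr j))) ∈ S}) hI.2 ?_⟩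
        refine card_le_card_of_injOn (fun j => σ I (Sum.inr j)) ?_ ?_
        · intro j hj
          have h := hVS (Function.Embedding.inl.trans (σ I).toEmbedding) (σ I (Sum.inr j))
          rw [hσ I (mem_powersetCard.1 hI.1).2] at h
          exact h.2 (mem_filter.1 hj).2
        · intro j _ k _ hjk
          exact Sum.inr_injective ((σ I).injective hjk)
    _ = b := by simp [hμ]

/-- Violation probability bound from the counting bound on all finite pools of samples. -/
theorem measure_violation_gt_le {n N : ℕ} (hnN : n ≤ N) {ε : ℝ} (h0 : 0 ≤ ε) (h1 : ε ≤ 1)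
    {S : Set ((Fin N → D) × D)} (hS : MeasurableSet S)
    (hV : ∀ T r : ℕ, r + n ≤ N + T → ∀ ω : Fin N ⊕ Fin T → D,
      ∃ V : Finset (Fin N ⊕ Fin T) → Finset (Fin N ⊕ Fin T),
      (∀ (σ : Fin N ↪ Fin N ⊕ Fin T) (e), e ∈ V (univ.map σ) ↔ (ω ∘ σ, ω e) ∈ S) ∧
      #{I ∈ powersetCard N univ | r < #(V I)} ≤
        ∑ i ∈ range n, (r + n).choose i * (N + T - r - n).choose (N - i)) :
    (Measure.pi fun _ : Fin N => P) {d | ε < P.real {e | (d, e) ∈ S}} ≤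
      ENNReal.ofReal (∑ i ∈ range n, (N.choose i : ℝ) * ε ^ i * (1 - ε) ^ (N - i)) := by
  classical
  set μ := Measure.pi fun _ : Fin N => P with hμ
  have hPm : Measurable fun d : Fin N → D => P.real {e | (d, e) ∈ S} :=
    (measurable_measure_prodMk_left hS).ennreal_toReal
  have key : ∀ δ : ℝ, 0 < δ → μ {d | ε + δ ≤ P.real {e | (d, e) ∈ S}} ≤
      ENNReal.ofReal (∑ i ∈ range n, (N.choose i : ℝ) * ε ^ i * (1 - ε) ^ (N - i)) := by
    intro δ hδ
    set Aδ := {d | ε + δ ≤ P.real {e | (d, e) ∈ S}} with hAδ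
    have hAm : MeasurableSet Aδ := measurableSet_le measurable_const hPm
    have hstep : ∀ T : ℕ, 0 < T → μ.real Aδ * (1 - 1 / (δ ^ 2 * T)) ≤
        ((∑ i ∈ range n, (⌊ε * T⌋₊ + n).choose i *
        (N + T - ⌊ε * T⌋₊ - n).choose (N - i) : ℕ) : ℝ) / ((N + T).choose N : ℝ) := by
      intro T hT
      have hfl : ⌊ε * T⌋₊ ≤ T :=
        Nat.floor_le_of_le (mul_le_of_le_one_left (Nat.cast_nonneg T) h1)
      have hle := measure_prod_card_lt_le P hS (hV T ⌊ε * T⌋₊ (by omega))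
      set ν := Measure.pi fun _ : Fin T => P with hν
      set A := {p : (Fin N → D) × (Fin T → D) | ⌊ε * T⌋₊ < #{j | (p.1, p.2 j) ∈ S}} with hA
      -- Conditionally on a training sample in `Aδ`, the fresh test sample shows more than `⌊ε T⌋`
      -- violations with probability at least `1 - 1 / (δ² T)`.
      have hlow : ENNReal.ofReal (1 - 1 / (δ ^ 2 * T)) * μ Aδ ≤ (μ.prod ν) A := by
        have hAm' : MeasurableSet A := measurableSet_lt_card hS _
        rw [Measure.prod_apply hAm']
        calc ENNReal.ofReal (1 - 1 / (δ ^ 2 * T)) * μ Aδ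
            = ∫⁻ _ in Aδ, ENNReal.ofReal (1 - 1 / (δ ^ 2 * T)) ∂μ := by
              rw [setLIntegral_const]
          _ ≤ ∫⁻ d in Aδ, ν (Prod.mk d ⁻¹' A) ∂μ := by
              refine setLIntegral_mono' hAm fun d hd => ?_
              have hcompl := prob_compl_eq_one_sub (μ := ν)
                ((measurable_prodMk_left (x := d)) hAm').compl
              rw [compl_compl] at hcompl
              rw [hcompl, ENNReal.ofReal_sub _ (by positivity), ENNReal.ofReal_one]
              refine tsub_le_tsub_left ?_ _
              have hcheb := measure_pi_card_le_floor P
                ((measurable_prodMk_left (x := d)) hS) h0 hδ hd hT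
              refine le_trans (measure_mono fun d' hd' => ?_) hcheb
              simpa [hA] using hd'
          _ ≤ ∫⁻ d, ν (Prod.mk d ⁻¹' A) ∂μ := setLIntegral_le_lintegral _ _
      have h2 : ((N + T).choose N : ENNReal) * (ENNReal.ofReal (1 - 1 / (δ ^ 2 * T)) * μ Aδ) ≤
        _ := (mul_le_mul_right hlow _).trans hle
      have h3 := ENNReal.toReal_mono (ENNReal.natCast_ne_top _) h2
      rw [ENNReal.toReal_mul, ENNReal.toReal_mul, ENNReal.toReal_natCast,
        ENNReal.toReal_natCast] at h3
      rw [le_div_iff₀ (by exact_mod_cast Nat.choose_pos (Nat.le_add_right N T))]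
      refine le_trans ?_ h3
      rw [mul_comm, mul_comm (μ.real Aδ)]
      refine mul_le_mul_of_nonneg_left (mul_le_mul_of_nonneg_right ?_ measureReal_nonneg)
        (Nat.cast_nonneg _)
      rw [ENNReal.toReal_ofReal']
      exact le_max_left _ _
    have hlim1 : Tendsto (fun T : ℕ => μ.real Aδ * (1 - 1 / (δ ^ 2 * T))) atTop
        (𝓝 (μ.real Aδ)) := by
      have h := (tendsto_const_div_atTop_nhds_zero_nat (1 / δ ^ 2)).const_sub 1 |>.const_mul
        (μ.real Aδ)
      rw [sub_zero, mul_one] at h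
      refine h.congr fun T => ?_
      rw [div_div]
    have hfin := le_of_tendsto_of_tendsto hlim1 (tendsto_hypergeometric_tail hnN h0 h1)
      (by filter_upwards [eventually_gt_atTop 0] with T hT using hstep T hT)
    rw [← ofReal_measureReal]
    exact ENNReal.ofReal_le_ofReal hfin
  -- The margin `δ` is removed by continuity from below along `δ = 1 / (k + 1)`.
  have hunion : {d | ε < P.real {e | (d, e) ∈ S}} =
      ⋃ k : ℕ, {d | ε + 1 / ((k : ℝ) + 1) ≤ P.real {e | (d, e) ∈ S}} := by
    ext d
    simp only [Set.mem_ofPred_eq, Set.mem_iUnion]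
    constructor
    · intro h
      obtain ⟨k, hk⟩ := exists_nat_one_div_lt (sub_pos.2 h)
      exact ⟨k, by linarith⟩
    · rintro ⟨k, hk⟩
      have : (0 : ℝ) < 1 / ((k : ℝ) + 1) := by positivity
      linarith
  rw [hunion, Monotone.measure_iUnion]
  · exact iSup_le fun k => key _ (by positivity)
  · intro k l hkl d hd
    simp only [Set.mem_ofPred_eq] at hd ⊢
    have : 1 / ((l : ℝ) + 1) ≤ 1 / ((k : ℝ) + 1) :=
      one_div_le_one_div_of_le (by positivity) (by exact_mod_cast Nat.succ_le_succ hkl)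
    linarith

end Probability

end Scenario

/-! ### Monotonicity of binomial tails. -/

namespace Scenario

open Finset

section BinomialTail

variable {ε : ℝ}

lemma binomialTail_nonneg (h0 : 0 ≤ ε) (h1 : ε ≤ 1) (n N : ℕ) :
    0 ≤ ∑ i ∈ range n, (N.choose i : ℝ) * ε ^ i * (1 - ε) ^ (N - i) :=
  Finset.sum_nonneg fun i _ => by
    have : 0 ≤ 1 - ε := by linarith
    positivity

/-- Conditioning on one trial makes the tail for `N + 1` a convex combination of the tails for `N`
with cutoffs `n` and `n - 1`, the latter being smaller. -/
lemma binomialTail_succ_le (h0 : 0 ≤ ε) (h1 : ε ≤ 1) (n N : ℕ) :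
    ∑ i ∈ range n, ((N + 1).choose i : ℝ) * ε ^ i * (1 - ε) ^ (N + 1 - i) ≤
      ∑ i ∈ range n, (N.choose i : ℝ) * ε ^ i * (1 - ε) ^ (N - i) := by
  rcases n with _ | n
  · simp
  set b : ℕ → ℝ := fun i => (N.choose i : ℝ) * ε ^ i * (1 - ε) ^ (N - i) with hb
  have hterm : ∀ i, (N.choose (i + 1) : ℝ) * ε ^ (i + 1) * (1 - ε) ^ (N + 1 - (i + 1)) =
      (1 - ε) * b (i + 1) := by
    intro i
    rcases lt_or_ge N (i + 1) with h | h
    · simp [hb, Nat.choose_eq_zero_of_lt h]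
    · rw [hb, show N + 1 - (i + 1) = (N - (i + 1)) + 1 by omega]
      ring
  have hrec : ∑ i ∈ range (n + 1), ((N + 1).choose i : ℝ) * ε ^ i * (1 - ε) ^ (N + 1 - i) =
      (1 - ε) * ∑ i ∈ range (n + 1), b i + ε * ∑ i ∈ range n, b i := by
    rw [Finset.sum_range_succ' _ n, Finset.sum_range_succ' b n, mul_add, Finset.mul_sum,
      Finset.mul_sum, add_right_comm, ← Finset.sum_add_distrib]
    congr 1
    · refine Finset.sum_congr rfl fun i _ => ?_
      rw [← hterm, Nat.choose_succ_succ, hb, Nat.add_sub_add_right]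
      push_cast
      ring
    · simp [hb, pow_succ, mul_comm]
  rw [hrec, Finset.sum_range_succ b n]
  have hbn : 0 ≤ b n := by
    have : 0 ≤ 1 - ε := by linarith
    positivity
  nlinarith

lemma one_le_binomialTail (h0 : 0 ≤ ε) (h1 : ε ≤ 1) {n N : ℕ} (h : N < n) :
    1 ≤ ∑ i ∈ range n, (N.choose i : ℝ) * ε ^ i * (1 - ε) ^ (N - i) := by
  have h2 : ∑ i ∈ range (N + 1), (N.choose i : ℝ) * ε ^ i * (1 - ε) ^ (N - i) = 1 := by
    have := add_pow ε (1 - ε) N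
    rw [add_sub_cancel, one_pow] at this
    exact (Finset.sum_congr rfl fun i _ => by ring).trans this.symm
  refine h2.symm.le.trans (Finset.sum_le_sum_of_subset_of_nonneg (range_subset_range.2 h) fun i _ _ => ?_)
  have : 0 ≤ 1 - ε := by linarith
  positivity

lemma tailSum_antitone {n m : ℕ} {ε : Fin m → ℝ} (hε : ∀ k, 0 ≤ ε k ∧ ε k ≤ 1) :
    Antitone (tailSum n ε) :=
  antitone_nat_of_succ_le fun N =>
    Finset.sum_le_sum fun k _ => binomialTail_succ_le (hε k).1 (hε k).2 n N

end BinomialTail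

/-! ### The violation bound for one scenario program. -/

section Single

variable {n : ℕ} {D : Type*} [MeasurableSpace D] {c : EuclideanSpace ℝ (Fin n)}
  {X : Set (EuclideanSpace ℝ (Fin n))} {f : EuclideanSpace ℝ (Fin n) → D → ℝ}

lemma exists_pool_optimizers (hopt : HasMeasurableUniqueOptimizer c X f) {ι : Type*}
    (ω : ι → D) : ∃ x : Finset ι → EuclideanSpace ℝ (Fin n), ∀ I : Finset ι, I.Nonempty →
      optimizers c {z | z ∈ X ∧ ∀ e ∈ I, f z (ω e) ≤ 0} = {x I} := by
  have : ∀ I : Finset ι, ∃ x, I.Nonempty →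
      optimizers c {z | z ∈ X ∧ ∀ e ∈ I, f z (ω e) ≤ 0} = {x} := by
    intro I
    by_cases hI : I.Nonempty
    · obtain ⟨x, -, hx⟩ := hopt #I (card_pos.2 hI)
      refine ⟨x fun i => ω (I.equivFin.symm i), fun _ => ?_⟩
      rw [← hx]
      congr 1
      ext z
      refine and_congr_right fun _ => ⟨fun h i => h _ (I.equivFin.symm i).2, fun h e he => ?_⟩
      have := h (I.equivFin ⟨e, he⟩)
      simpa only [Equiv.symm_apply_apply] using this
    · exact ⟨0, fun h => absurd h hI⟩
  choose x hx using this
  exact ⟨x, hx⟩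

lemma measurable_comp_prod (hfmeas : Measurable fun p : X × D => f p.1 p.2) {N : ℕ}
    {x : (Fin N → D) → EuclideanSpace ℝ (Fin n)} (hxm : Measurable x) (hxX : ∀ d, x d ∈ X) :
    Measurable fun p : (Fin N → D) × D => f (x p.1) p.2 :=
  hfmeas.comp (((hxm.comp measurable_fst).subtype_mk (h := fun p => hxX p.1)).prodMk
    measurable_snd)

/-- The violation probability of the optimizer of a convex scenario program exceeds `ε` with
probability at most a binomial tail. -/
theorem measure_scp_violation_le (P : Measure D) [IsProbabilityMeasure P]
    (hfmeas : Measurable fun p : X × D => f p.1 p.2)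
    (hfconvex : ∀ d, ConvexOn ℝ X fun x => f x d)
    (hopt : HasMeasurableUniqueOptimizer c X f) {ε : ℝ} (h0 : 0 ≤ ε) (h1 : ε ≤ 1)
    {N : ℕ} (hN : 1 ≤ N) {x : (Fin N → D) → EuclideanSpace ℝ (Fin n)} (hxm : Measurable x)
    (hx : ∀ d, optimizers c (scpFeasible X f d) = {x d}) :
    (Measure.pi fun _ : Fin N => P) {d | ε < P.real {e | 0 < f (x d) e}} ≤
      ENNReal.ofReal (∑ i ∈ range n, (N.choose i : ℝ) * ε ^ i * (1 - ε) ^ (N - i)) := by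
  classical
  rcases lt_or_ge N n with hNn | hnN
  -- With fewer samples than dimensions the tail is the full binomial expansion, so the bound is
  -- trivial.
  · refine prob_le_one.trans ?_
    rw [← ENNReal.ofReal_one]
    exact ENNReal.ofReal_le_ofReal (one_le_binomialTail h0 h1 hNn)
  have hxX : ∀ d, x d ∈ X := fun d => by
    have h : x d ∈ optimizers c (scpFeasible X f d) := by rw [hx]; rfl
    exact h.1.1
  have hS : MeasurableSet {p : (Fin N → D) × D | 0 < f (x p.1) p.2} :=
    measurableSet_lt measurable_const (measurable_comp_prod hfmeas hxm hxX)
  refine measure_violation_gt_le P hnN h0 h1 hS fun T r hr ω => ?_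
  obtain ⟨y, hy⟩ := exists_pool_optimizers hopt ω
  set C : Fin N ⊕ Fin T → Set (EuclideanSpace ℝ (Fin n)) := fun e => {z | z ∈ X ∧ f z (ω e) ≤ 0}
    with hC
  have hyopt : ∀ I : Finset (Fin N ⊕ Fin T), I.Nonempty →
      y I ∈ optimizers c {z | z ∈ X ∧ ∀ e ∈ I, f z (ω e) ≤ 0} := fun I hI => by
    rw [hy I hI]; rfl
  refine ⟨fun I => {e | y I ∉ C e}, fun σ e => ?_, ?_⟩
  · have hne : (univ.map σ).Nonempty := by
      rw [map_nonempty]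
      exact ⟨⟨0, hN⟩, mem_univ _⟩
    have hset : {z | z ∈ X ∧ ∀ e ∈ univ.map σ, f z (ω e) ≤ 0} = scpFeasible X f (ω ∘ σ) := by
      ext z
      simp [scpFeasible]
    have hyx : y (univ.map σ) = x (ω ∘ σ) := by
      -- Uniqueness makes the optimizer independent of the order of its samples.
      rw [← Set.singleton_eq_singleton_iff, ← hy _ hne, hset, hx]
    simp only [mem_filter, mem_univ, true_and, hyx, hC, Set.mem_ofPred_eq, hxX, not_le]
  · have hcard := card_filter_not_mem_le (ι := Fin N ⊕ Fin T) (n := n) (N := N) (r := r)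
      (by simp) hN hnN (by simpa using hr) (C := C) (fun e => (hfconvex _).convex_le 0) c y
      fun I hI => ⟨fun e he => ⟨(hyopt I hI).1.1, (hyopt I hI).1.2 e he⟩, fun z hz hle => ?_⟩
    · rw [Fintype.card_sum, Fintype.card_fin, Fintype.card_fin] at hcard
      convert hcard
    · have hzopt : z ∈ optimizers c {z | z ∈ X ∧ ∀ e ∈ I, f z (ω e) ≤ 0} := by
        obtain ⟨e₀, he₀⟩ := hI
        exact ⟨⟨(hz e₀ he₀).1, fun e he => (hz e he).2⟩,
          fun w hw => hle.trans ((hyopt I ⟨e₀, he₀⟩).2 w hw)⟩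
      rw [hy I hI] at hzopt
      exact hzopt

lemma measurableSet_ccpFeasible (P : Measure D) [IsProbabilityMeasure P] (hX : MeasurableSet X)
    (hfmeas : Measurable fun p : X × D => f p.1 p.2) (ε : ℝ) :
    MeasurableSet (ccpFeasible P X f ε) := by
  have hS : MeasurableSet {p : X × D | f p.1 p.2 ≤ 0} := measurableSet_le hfmeas measurable_const
  have hm : Measurable fun z : X => P.real {d | f z d ≤ 0} :=
    (measurable_measure_prodMk_left hS).ennreal_toReal
  have h := hX.subtype_image (measurableSet_le (measurable_const (a := 1 - ε)) hm)
  convert h using 1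
  ext z
  simp [ccpFeasible, and_comm]

lemma lt_violation_of_notMem_ccpFeasible (P : Measure D) [IsProbabilityMeasure P]
    (hfmeas : Measurable fun p : X × D => f p.1 p.2) {ε : ℝ} {z : EuclideanSpace ℝ (Fin n)}
    (hz : z ∈ X) (hzc : z ∉ ccpFeasible P X f ε) : ε < P.real {e | 0 < f z e} := by
  have hm : MeasurableSet {e | f z e ≤ 0} :=
    measurableSet_le (hfmeas.comp (measurable_prodMk_left (x := (⟨z, hz⟩ : X)))) measurable_const
  have h1 : P.real {e | f z e ≤ 0} < 1 - ε := not_le.1 fun h => hzc ⟨hz, h⟩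
  have h2 := probReal_compl_eq_one_sub (μ := P) hm
  have h3 : {e | f z e ≤ 0}ᶜ = {e | 0 < f z e} := by
    ext e; simp
  rw [h3] at h2
  linarith

end Single

/-! ### Optimizers over the union of feasible sets. -/

section Union

variable {n m : ℕ} {D : Type*} {c : EuclideanSpace ℝ (Fin n)}
  {X : Fin m → Set (EuclideanSpace ℝ (Fin n))} {f : Fin m → EuclideanSpace ℝ (Fin n) → D → ℝ}

/-- A minimizer over a union also minimizes over any piece containing it, where it is unique. -/
lemma mem_optimizers_spFeasible_iff {N : ℕ} {d : Fin N → D}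
    {x : Fin m → EuclideanSpace ℝ (Fin n)}
    (hx : ∀ k, optimizers c (scpFeasible (X k) (f k) d) = {x k}) (z : EuclideanSpace ℝ (Fin n)) :
    z ∈ optimizers c (spFeasible X f d) ↔ ∃ k, z = x k ∧ ∀ j, inner ℝ c (x k) ≤ inner ℝ c (x j) := by
  have hxo : ∀ k, x k ∈ optimizers c (scpFeasible (X k) (f k) d) := fun k => by rw [hx]; rfl
  constructor
  · rintro ⟨⟨k, hk⟩, hmin⟩
    have hz : z ∈ optimizers c (scpFeasible (X k) (f k) d) := ⟨hk, fun w hw => hmin w ⟨k, hw⟩⟩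
    rw [hx] at hz
    obtain rfl : z = x k := hz
    exact ⟨k, rfl, fun j => hmin _ ⟨j, (hxo j).1⟩⟩
  · rintro ⟨k, rfl, hmin⟩
    exact ⟨⟨k, (hxo k).1⟩, fun w ⟨j, hj⟩ => (hmin j).trans ((hxo j).2 w hj)⟩

/-- Solvability for each single sample forces the only point of `ℝ⁰` to satisfy every constraint. -/
lemma spFeasible_subset_cpFeasible_of_isEmpty [MeasurableSpace D] (P : Measure D)
    [IsProbabilityMeasure P] {X : Fin m → Set (EuclideanSpace ℝ (Fin 0))}
    {f : Fin m → EuclideanSpace ℝ (Fin 0) → D → ℝ} {c : EuclideanSpace ℝ (Fin 0)}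
    {ε : Fin m → ℝ} (hε : ∀ k, 0 ≤ ε k)
    (hopt : ∀ k, HasMeasurableUniqueOptimizer c (X k) (f k)) {N : ℕ} (d : Fin N → D) :
    spFeasible X f d ⊆ cpFeasible P X f ε := by
  rintro z ⟨k, hz⟩
  refine ⟨k, hz.1, ?_⟩
  have huniv : {e | f k z e ≤ 0} = Set.univ := by
    refine Set.eq_univ_of_forall fun e => ?_
    obtain ⟨x, -, hx⟩ := hopt k 1 le_rfl
    have h : x (fun _ => e) ∈ optimizers c (scpFeasible (X k) (f k) fun _ : Fin 1 => e) := by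
      rw [hx]; rfl
    have h2 := h.1.2 0
    rwa [Subsingleton.elim (x fun _ => e) z] at h2
  rw [huniv, probReal_univ]
  linarith [hε k]

end Union

end Scenario

open Scenario

theorem theorem4p1 {n m : ℕ} (hm : 1 ≤ m)
    {D : Type*} [MetricSpace D] [MeasurableSpace D] [BorelSpace D]
    (P : Measure D) [IsProbabilityMeasure P]
    (c : EuclideanSpace ℝ (Fin n))
    (X : Fin m → Set (EuclideanSpace ℝ (Fin n)))
    (f : Fin m → EuclideanSpace ℝ (Fin n) → D → ℝ)
    (ε : Fin m → ℝ) (hε : ∀ k, 0 ≤ ε k ∧ ε k ≤ 1)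
    (hXcompact : ∀ k, IsCompact (X k)) (hXconvex : ∀ k, Convex ℝ (X k))
    (hfmeas : ∀ k, Measurable (fun p : X k × D => f k p.1 p.2))
    (hfconvex : ∀ k, ∀ d, ConvexOn ℝ (X k) (fun x => f k x d))
    (hfbdd : ∀ k, ∀ x ∈ X k, ∃ M : ℝ, ∀ d, |f k x d| ≤ M)
    (hopt : ∀ k, Scenario.HasMeasurableUniqueOptimizer c (X k) (f k))
    (β : ℝ) (hβ : 0 < β) (hβ1 : β ≤ 1)
    (Nmin : ℕ) (hNmin : IsLeast {M : ℕ | Scenario.tailSum n ε M ≤ β} Nmin)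
    (N : ℕ) (hN : Nmin ≤ N) :
    (∀ d : Fin N → D, (Scenario.optimizers c (Scenario.spFeasible X f d)).Nonempty) ∧
    MeasurableSet {d : Fin N → D |
      Scenario.optimizers c (Scenario.spFeasible X f d) ⊆ Scenario.cpFeasible P X f ε} ∧
    1 - β ≤ (Measure.pi (fun _ : Fin N => P)).real {d : Fin N → D |
      Scenario.optimizers c (Scenario.spFeasible X f d) ⊆ Scenario.cpFeasible P X f ε} := by
  have htail : tailSum n ε N ≤ β := (tailSum_antitone hε hN).trans hNmin.1
  have : Nonempty (Fin m) := ⟨⟨0, hm⟩⟩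
  -- Unique solvability is assumed only from sample size 1 on. For `N = 0` compactness gives an
  -- optimizer, and for `n > 0` the tail sum is at least 1, so `1 - β ≤ 0`.
  rcases Nat.eq_zero_or_pos N with rfl | hNpos
  · refine ⟨fun d => ?_, Subsingleton.measurableSet, ?_⟩
    · have hset : spFeasible X f d = ⋃ k, X k := by
        ext z
        simp [spFeasible, scpFeasible]
      have hne : (⋃ k, X k).Nonempty := by
        obtain ⟨e⟩ := P.nonempty_of_neZero
        obtain ⟨x, -, hx⟩ := hopt ⟨0, hm⟩ 1 le_rfl
        have h : x (fun _ => e) ∈ optimizers c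
            (scpFeasible (X ⟨0, hm⟩) (f ⟨0, hm⟩) fun _ : Fin 1 => e) := by rw [hx]; rfl
        exact ⟨_, Set.mem_iUnion.2 ⟨_, h.1.1⟩⟩
      obtain ⟨z, hz, hmin⟩ := (isCompact_iUnion hXcompact).exists_isMinOn hne
        (f := fun z => inner ℝ c z) (by fun_prop)
      rw [hset]
      exact ⟨z, hz, fun w hw => hmin hw⟩
    · rcases Nat.eq_zero_or_pos n with rfl | hn
      · have huniv : {d : Fin 0 → D | optimizers c (spFeasible X f d) ⊆ cpFeasible P X f ε} =
            Set.univ := Set.eq_univ_of_forall fun d z hz =>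
          spFeasible_subset_cpFeasible_of_isEmpty P (fun k => (hε k).1) hopt d hz.1
        rw [huniv, probReal_univ]
        linarith
      · have h1 : 1 ≤ tailSum n ε 0 :=
          (one_le_binomialTail (hε ⟨0, hm⟩).1 (hε ⟨0, hm⟩).2 hn).trans
            (Finset.single_le_sum (f := fun k => ∑ i ∈ Finset.range n,
              ((0 : ℕ).choose i : ℝ) * ε k ^ i * (1 - ε k) ^ (0 - i))
              (fun k _ => binomialTail_nonneg (hε k).1 (hε k).2 n 0) (Finset.mem_univ _))
        exact le_trans (by linarith) measureReal_nonneg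
  choose x hxm hx using fun k => hopt k N hNpos
  have hxX : ∀ k d, x k d ∈ X k := fun k d => by
    have h : x k d ∈ optimizers c (scpFeasible (X k) (f k) d) := by rw [hx]; rfl
    exact h.1.1
  have hiff := fun d => mem_optimizers_spFeasible_iff fun k => hx k d
  set G : Set (Fin N → D) :=
    {d | optimizers c (spFeasible X f d) ⊆ cpFeasible P X f ε} with hG
  have hcp : MeasurableSet (cpFeasible P X f ε) := by
    have h : cpFeasible P X f ε = ⋃ k, ccpFeasible P (X k) (f k) (ε k) := by
      ext z
      simp [cpFeasible]
    rw [h]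
    exact MeasurableSet.iUnion fun k =>
      measurableSet_ccpFeasible P (hXcompact k).measurableSet (hfmeas k) (ε k)
  have hGm : MeasurableSet G := by
    -- Each `x k d` must either be beaten by some `x j d` or be feasible; this covers all ties.
    have h : G = ⋂ k, ((⋂ j, {d | inner ℝ c (x k d) ≤ inner ℝ c (x j d)})ᶜ ∪
        x k ⁻¹' cpFeasible P X f ε) := by
      ext d
      simp only [hG, Set.mem_ofPred_eq, Set.subset_def, hiff, Set.mem_iInter, Set.mem_union,
        Set.mem_compl_iff, Set.mem_preimage, ← imp_iff_not_or]
      exact ⟨fun h k hk => h _ ⟨k, rfl, hk⟩, fun h z ⟨k, hz, hk⟩ => hz ▸ h k hk⟩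
    rw [h]
    refine MeasurableSet.iInter fun k => MeasurableSet.union (MeasurableSet.compl
      (MeasurableSet.iInter fun j => measurableSet_le ?_ ?_)) (hxm k hcp)
    · exact (hxm k).const_inner
    · exact (hxm j).const_inner
  refine ⟨fun d => ?_, hGm, ?_⟩
  · obtain ⟨k, hk⟩ := Finite.exists_min fun k => inner ℝ c (x k d)
    exact ⟨x k d, (hiff d _).2 ⟨k, rfl, hk⟩⟩
  · have hbad : (Measure.pi fun _ : Fin N => P).real Gᶜ ≤ β := by
      have hsub : Gᶜ ⊆ ⋃ k, {d | ε k < P.real {e | 0 < f k (x k d) e}} := by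
        intro d hd
        obtain ⟨z, hz, hzc⟩ := Set.not_subset.1 hd
        obtain ⟨k, rfl, -⟩ := (hiff d z).1 hz
        exact Set.mem_iUnion.2 ⟨k, lt_violation_of_notMem_ccpFeasible P (hfmeas k) (hxX k d)
          fun h => hzc ⟨k, h⟩⟩
      refine le_trans (ENNReal.toReal_le_of_le_ofReal ?_ ?_) htail
      · exact Finset.sum_nonneg fun k _ => binomialTail_nonneg (hε k).1 (hε k).2 n N
      · refine (measure_mono hsub).trans ((measure_iUnion_fintype_le _ _).trans ?_)
        rw [tailSum, ENNReal.ofReal_sum_of_nonneg fun k _ =>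
          binomialTail_nonneg (hε k).1 (hε k).2 n N]
        exact Finset.sum_le_sum fun k _ => measure_scp_violation_le P (hfmeas k) (hfconvex k)
          (hopt k) (hε k).1 (hε k).2 hNpos (hxm k) (hx k)
    rw [probReal_compl_eq_one_sub hGm] at hbad
    linarith
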